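/- Let $\mathbb{D}=\{a+b\epsilon: a,b\in\mathbb{R}\}$ and $\mathbb{DQ}=\{p+q\epsilon: p,q\in\mathbb{Q}\}$ denote the dual numbers and the dual quaternions ($\mathbb{Q}$ the real quaternions, $\epsilon$ central, $\epsilon^2=0$, conjugation $(p+q\epsilon)^*=p^*+q^*\epsilon$), and order $\mathbb{D}$ totally by: $a+b\epsilon<c+d\epsilon$ iff $a<c$, or $a=c$ and $b<d$. A vector $\hat{\mathbf v}\in\mathbb{DQ}^n$ is appreciable if its standard part (the coefficient of $\epsilon^0$) is nonzero. A right eigenvalue of $\hat A\in\mathbb{DQ}^{n\times n}$ is a $\hat\lambda\in\mathbb{DQ}$ such that $\hat A\hat{\mathbf x}=\hat{\mathbf x}\hat\lambda$ for some appreciable $\hat{\mathbf x}\in\mathbb{DQ}^n$ (an eigenvector for $\hat\lambda$). For appreciable $\hat{\mathbf v}$ put $\theta(\hat A,\hat{\mathbf v})=(\hat{\mathbf v}^*\hat A\hat{\mathbf v})(\hat{\mathbf v}^*\hat{\mathbf v})^{-1}$. Let $n\ge 1$ and let $\hat A\in\mathbb{DQ}^{n\times n}$ be Hermitian, $\hat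 A^*=\hat A$. Then: (1) If $\lambda_1\le\lambda_2\le\cdots\le\lambda_n$ is any list of dual numbers, repetitions allowed, whose set of entries is exactly the set of dual numbers that are right eigenvalues of $\hat A$ (for instance the list of eigenvalues counted with multiplicity), then for every appreciable $\hat{\mathbf v}\in\mathbb{DQ}^n$ the Rayleigh quotient $\theta(\hat A,\hat{\mathbf v})$ is a dual number and $$\lambda_1\le\theta(\hat A,\hat{\mathbf v})\le\lambda_n .$$ (2) All right eigenvalues of $\hat A$ are dual numbers; there are a smallest one $\lambda_{\min}$ and a largest one $\lambda_{\max}$. The least dual number among the values $\theta(\hat A,\hat{\mathbf v})$, $\hat{\mathbf v}$ appreciable, exists and equals $\lambda_{\min}$, and it is attained at every eigenvector for $\lambda_{\min}$; the greatest such value exists and equals $\lambda_{\max}$, and it is attained at every eigenvector for $\lambda_{\max}$. -/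

import Mathlib

open scoped Quaternion

noncomputable section

namespace DualQuat

/-- The ring `𝔻` of dual numbers `a + b ε` with `a b : ℝ` and `ε ^ 2 = 0`. -/
abbrev DNum : Type := DualNumber ℝ

/-- The ring `𝔻ℚ` of dual quaternions `p + q ε` with `p q : ℍ[ℝ]`; `ε` is central and
`ε ^ 2 = 0`. The standard part is `fst`, the dual part is `snd`. -/
abbrev DQuat : Type := DualNumber ℍ[ℝ]

/-- The total order on the dual numbers: lexicographic in (standard part, dual part). -/
instance instLinearOrderDNum : LinearOrder DNum :=
  LinearOrder.lift' (fun p : DNum => toLex (p.fst, p.snd)) (by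
    intro p q h
    have h' : (p.fst, p.snd) = (q.fst, q.snd) := toLex.injective h
    exact TrivSqZeroExt.ext (congrArg Prod.fst h') (congrArg Prod.snd h'))

theorem dnum_lt_iff (p q : DNum) :
    p < q ↔ p.fst < q.fst ∨ (p.fst = q.fst ∧ p.snd < q.snd) :=
  Prod.Lex.toLex_lt_toLex

theorem dnum_le_iff (p q : DNum) :
    p ≤ q ↔ p.fst < q.fst ∨ (p.fst = q.fst ∧ p.snd ≤ q.snd) :=
  Prod.Lex.toLex_le_toLex

/-- The conjugation `(p + q ε)* = p* + q* ε` on dual quaternions. -/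
instance instStarRingDQuat : StarRing DQuat where
  star q := TrivSqZeroExt.inl (star q.fst) + TrivSqZeroExt.inr (star q.snd)
  star_involutive q := by ext : 1 <;> simp
  star_mul p q := by ext : 1 <;> simp [add_comm]
  star_add p q := by ext : 1 <;> simp

theorem fst_star (q : DQuat) : (star q).fst = star q.fst := by
  change (TrivSqZeroExt.inl (star q.fst) + TrivSqZeroExt.inr (star q.snd) : DQuat).fst = _
  simp

theorem snd_star (q : DQuat) : (star q).snd = star q.snd := by
  change (TrivSqZeroExt.inl (star q.fst) + TrivSqZeroExt.inr (star q.snd) : DQuat).snd = _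
  simp

/-- The inclusion of the dual numbers into the dual quaternions. -/
def ofDNum (t : DNum) : DQuat :=
  TrivSqZeroExt.inl (t.fst : ℍ[ℝ]) + TrivSqZeroExt.inr (t.snd : ℍ[ℝ])

/-- A dual quaternion vector is appreciable if its standard part is not the zero vector. -/
def Appreciable {n : ℕ} (v : Fin n → DQuat) : Prop :=
  (fun i => (v i).fst) ≠ 0

/-- `v` is a right eigenvector of `A` for `μ`: it is appreciable and `A v = v μ`. -/
def IsRightEigenvector {n : ℕ} (A : Matrix (Fin n) (Fin n) DQuat) (μ : DQuat)
    (v : Fin n → DQuat) : Prop :=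
  Appreciable v ∧ A.mulVec v = fun i => v i * μ

/-- `μ` is a right eigenvalue of `A`. -/
def IsRightEigenvalue {n : ℕ} (A : Matrix (Fin n) (Fin n) DQuat) (μ : DQuat) : Prop :=
  ∃ v : Fin n → DQuat, IsRightEigenvector A μ v

/-- The dual numbers that are right eigenvalues of `A`. -/
def eigenvalues {n : ℕ} (A : Matrix (Fin n) (Fin n) DQuat) : Set DNum :=
  {t | IsRightEigenvalue A (ofDNum t)}

/-- The Rayleigh quotient `(v* A v) (v* v)⁻¹`, computed in the dual quaternions, where
`(p + q ε)⁻¹ = p⁻¹ - p⁻¹ q p⁻¹ ε` for `p ≠ 0`. -/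
def rayleigh {n : ℕ} (A : Matrix (Fin n) (Fin n) DQuat) (v : Fin n → DQuat) : DQuat :=
  dotProduct (star v) (A.mulVec v) * (dotProduct (star v) v)⁻¹

/-- The dual numbers that are values of the Rayleigh quotient at appreciable vectors. -/
def rayleighValues {n : ℕ} (A : Matrix (Fin n) (Fin n) DQuat) : Set DNum :=
  {t | ∃ v : Fin n → DQuat, Appreciable v ∧ rayleigh A v = ofDNum t}

end DualQuat

end

/-! Write `A = P + Q ε` and `v = x + y ε`. As `A` is Hermitian, `v* A v` and `v* v` are
self-conjugate, hence dual numbers, hence central, and only real parts need computing. This turns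
the problem into one about symmetric operators on the real Euclidean space underlying `ℍ ^ n`.

The standard part of the Rayleigh quotient is the ordinary quotient of `P` at `x`, bounded below by
the least eigenvalue `a`. In the lexicographic order the dual part matters only at ties, which force
`x ∈ ker (P - a)`; there `y` cancels and the dual part is the quotient of `Q` at `x`. Its minimum
`b` is the least eigenvalue of the compression of `Q` to that kernel. A minimizer `x` extends to an
eigenvector `x + y ε` for `a + b ε`, because `(P - a) y = b x - Q x` is solvable
(`exists_min_perturbed_eigenvector`). The maximum follows by passing to `-A`. -/

namespace LinearMap.IsSymmetric

variable {E : Type*} [NormedAddCommGroup E] [InnerProductSpace ℝ E]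

/-- The smallest eigenvalue of a symmetric operator minimizes its quadratic form. -/
theorem exists_min_eigenvector [FiniteDimensional ℝ E] [Nontrivial E] {T : E →ₗ[ℝ] E}
    (hT : T.IsSymmetric) :
    ∃ (a : ℝ) (x : E), x ≠ 0 ∧ T x = a • x ∧ ∀ y, a * ‖y‖ ^ 2 ≤ inner ℝ (T y) y := by
  obtain ⟨x, hx⟩ := hT.hasEigenvalue_iInf_of_finiteDimensional.exists_hasEigenvector
  refine ⟨_, x, hx.2, hx.apply_eq_smul, fun y => ?_⟩
  rcases eq_or_ne y 0 with rfl | hy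
  · simp
  have hy' : 0 < ‖y‖ ^ 2 := by positivity
  rw [← le_div_iff₀ hy']
  refine ciInf_le (f := fun x : {x : E // x ≠ 0} => RCLike.re (inner ℝ (T x) (x : E)) / ‖(x : E)‖ ^ 2)
    ⟨-‖T.toContinuousLinearMap‖, ?_⟩ ⟨y, hy⟩
  rintro _ ⟨⟨z, hz⟩, rfl⟩
  have hz' : 0 < ‖z‖ ^ 2 := by positivity
  rw [le_div_iff₀ hz']
  have h1 := (abs_le.1 (abs_real_inner_le_norm (T z) z)).1
  have h2 : ‖T z‖ ≤ ‖T.toContinuousLinearMap‖ * ‖z‖ := T.toContinuousLinearMap.le_opNorm z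
  have h3 := mul_le_mul_of_nonneg_right h2 (norm_nonneg z)
  simp only [RCLike.re_to_real]
  nlinarith

/-- The nonnegative form at `x + t • T x` is a quadratic in `t` without constant term, so its linear
coefficient `2 * ‖T x‖ ^ 2` must vanish. -/
theorem apply_eq_zero_of_inner_eq_zero {T : E →ₗ[ℝ] E} (hT : T.IsSymmetric)
    (hpos : ∀ y, 0 ≤ inner ℝ (T y) y) {x : E} (hx : inner ℝ (T x) x = 0) : T x = 0 := by
  set c := inner ℝ (T (T x)) (T x)
  have hc : 0 ≤ c := hpos (T x)
  have key : ∀ t : ℝ, 0 ≤ 2 * t * ‖T x‖ ^ 2 + t ^ 2 * c := fun t => by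
    have h := hpos (x + t • T x)
    rw [map_add, map_smul, inner_add_left, inner_add_right, inner_add_right, hx,
      real_inner_smul_left, real_inner_smul_left, real_inner_smul_right, real_inner_smul_right,
      hT (T x) x, real_inner_self_eq_norm_sq] at h
    linarith
  -- The minimizing `t` would have denominator `c`; `c + 1` also covers `c = 0`.
  have h := key (-‖T x‖ ^ 2 / (c + 1))
  have hc1 : 0 < c + 1 := by linarith
  have h' : 2 * (-‖T x‖ ^ 2 / (c + 1)) * ‖T x‖ ^ 2 + (-‖T x‖ ^ 2 / (c + 1)) ^ 2 * c
      = -((c + 2) * (‖T x‖ ^ 2) ^ 2) / (c + 1) ^ 2 := by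
    field_simp; ring
  rw [h', le_div_iff₀ (by positivity), zero_mul] at h
  have : (‖T x‖ ^ 2) ^ 2 = 0 := by nlinarith [sq_nonneg (‖T x‖ ^ 2)]
  simpa using this

/-- First-order perturbation of the smallest eigenvalue of `P` in the direction `Q`. -/
theorem exists_min_perturbed_eigenvector [FiniteDimensional ℝ E] [Nontrivial E]
    {P Q : E →ₗ[ℝ] E} (hP : P.IsSymmetric) (hQ : Q.IsSymmetric) :
    ∃ (a b : ℝ) (x y : E), x ≠ 0 ∧ P x = a • x ∧ Q x + P y = a • y + b • x ∧
      (∀ z, a * ‖z‖ ^ 2 ≤ inner ℝ (P z) z) ∧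
      ∀ z, inner ℝ (P z) z = a * ‖z‖ ^ 2 → P z = a • z ∧ b * ‖z‖ ^ 2 ≤ inner ℝ (Q z) z := by
  obtain ⟨a, x₀, hx₀, hPx₀, hmin⟩ := hP.exists_min_eigenvector
  set T : E →ₗ[ℝ] E := P - a • LinearMap.id
  have hTapp : ∀ z, T z = P z - a • z := fun z => rfl
  have hT : T.IsSymmetric := fun u v => by
    simp only [hTapp, inner_sub_left, inner_sub_right, hP u v, real_inner_smul_left,
      real_inner_smul_right]
  have hTin : ∀ z, inner ℝ (T z) z = inner ℝ (P z) z - a * ‖z‖ ^ 2 := fun z => by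
    rw [hTapp, inner_sub_left, real_inner_smul_left, real_inner_self_eq_norm_sq]
  have hTpos : ∀ z, 0 ≤ inner ℝ (T z) z := fun z => by
    rw [hTin]; linarith [hmin z]
  set V := LinearMap.ker T
  have : Nontrivial V :=
    ⟨⟨x₀, by rw [LinearMap.mem_ker, hTapp, hPx₀, sub_self]⟩, 0, fun h => hx₀ (congrArg Subtype.val h)⟩
  -- The compression of `Q` to the `a`-eigenspace of `P`.
  set C : V →ₗ[ℝ] V := V.subtype.adjoint ∘ₗ Q ∘ₗ V.subtype
  have hCin : ∀ u v : V, inner ℝ (C u) v = inner ℝ (Q u) (v : E) := fun u v =>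
    LinearMap.adjoint_inner_left V.subtype v (Q u)
  have hC : C.IsSymmetric := fun u v => by
    rw [hCin, real_inner_comm (C v) u, hCin, hQ, real_inner_comm]
  obtain ⟨b, x, hx, hCx, hbmin⟩ := hC.exists_min_eigenvector
  have hTx : P x = a • (x : E) := sub_eq_zero.1 x.2
  have horth : b • (x : E) - Q x ∈ Vᗮ := by
    rw [Submodule.mem_orthogonal']
    intro u hu
    have h := hCin x ⟨u, hu⟩
    rw [hCx] at h
    rw [inner_sub_left, ← h, real_inner_smul_left, real_inner_smul_left, sub_eq_zero]
    rfl
  -- Fredholm alternative: `(ker T)ᗮ` is the range of the adjoint, here `T` itself.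
  rw [LinearMap.orthogonal_ker, ← LinearMap.star_eq_adjoint,
    ((LinearMap.isSymmetric_iff_isSelfAdjoint T).1 hT).star_eq] at horth
  obtain ⟨y, hy⟩ := horth
  refine ⟨a, b, x, y, fun h => hx (Subtype.ext h), hTx, ?_, hmin, fun z hz => ?_⟩
  · rw [hTapp] at hy
    rw [eq_add_of_sub_eq hy]; abel
  · have hz0 : T z = 0 := hT.apply_eq_zero_of_inner_eq_zero hTpos (by rw [hTin, hz, sub_self])
    refine ⟨sub_eq_zero.1 hz0, ?_⟩
    have h := hbmin ⟨z, hz0⟩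
    rwa [hCin] at h

end LinearMap.IsSymmetric

namespace DualQuat

/-! ### Reduction to real inner products. -/

/-- The real Euclidean space underlying `ℍ ^ n`. -/
abbrev QuatSpace (n : ℕ) : Type := PiLp 2 (fun _ : Fin n => ℍ[ℝ])

/-- The real-linear operator on `ℍ ^ n` given by a quaternion matrix. -/
def quatOp {n : ℕ} (M : Matrix (Fin n) (Fin n) ℍ[ℝ]) : QuatSpace n →ₗ[ℝ] QuatSpace n where
  toFun x := WithLp.toLp 2 (M.mulVec x.ofLp)
  map_add' x y := by rw [WithLp.ofLp_add, Matrix.mulVec_add, WithLp.toLp_add]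
  map_smul' c x := by
    rw [WithLp.ofLp_smul, Matrix.mulVec_smul, WithLp.toLp_smul, RingHom.id_apply]

variable {n : ℕ}

theorem re_star_dotProduct (v w : Fin n → ℍ[ℝ]) :
    (dotProduct (star v) w).re = inner ℝ (WithLp.toLp 2 w : QuatSpace n) (WithLp.toLp 2 v) := by
  have h : ∀ f : Fin n → ℍ[ℝ], (∑ i, f i).re = ∑ i, (f i).re :=
    fun f => map_sum (⟨⟨fun q => q.re, rfl⟩, fun _ _ => rfl⟩ : ℍ[ℝ] →+ ℝ) f _
  rw [dotProduct, h, PiLp.inner_apply]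
  refine Finset.sum_congr rfl fun i _ => ?_
  rw [Quaternion.inner_def]
  simp
  ring

theorem star_dotProduct_mulVec {R : Type*} [Ring R] [StarRing R]
    {M : Matrix (Fin n) (Fin n) R} (hM : M.IsHermitian) (v w : Fin n → R) :
    dotProduct (star v) (M.mulVec w) = dotProduct (star (M.mulVec v)) w := by
  rw [Matrix.star_mulVec, hM.eq, Matrix.dotProduct_mulVec]

theorem quatOp_isSymmetric {M : Matrix (Fin n) (Fin n) ℍ[ℝ]} (hM : M.IsHermitian) :
    (quatOp M).IsSymmetric := fun x y => by
  have h1 := re_star_dotProduct y.ofLp (M.mulVec x.ofLp)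
  have h2 := re_star_dotProduct (M.mulVec y.ofLp) x.ofLp
  rw [← star_dotProduct_mulVec hM] at h2
  exact h1.symm.trans h2

/-- The standard part of a dual quaternion vector. -/
def stdPart (v : Fin n → DQuat) : QuatSpace n := WithLp.toLp 2 fun i => (v i).fst

/-- The dual part of a dual quaternion vector. -/
def dualPart (v : Fin n → DQuat) : QuatSpace n := WithLp.toLp 2 fun i => (v i).snd

theorem appreciable_iff {v : Fin n → DQuat} : Appreciable v ↔ stdPart v ≠ 0 :=
  (WithLp.toLp_eq_zero 2).not.symm

theorem fst_dotProduct (v w : Fin n → DQuat) :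
    (dotProduct v w).fst = dotProduct (fun i => (v i).fst) (fun i => (w i).fst) := by
  simp [dotProduct, TrivSqZeroExt.fst_sum]

theorem snd_dotProduct (v w : Fin n → DQuat) :
    (dotProduct v w).snd = dotProduct (fun i => (v i).fst) (fun i => (w i).snd) +
      dotProduct (fun i => (v i).snd) (fun i => (w i).fst) := by
  simp [dotProduct, TrivSqZeroExt.snd_sum, Finset.sum_add_distrib]

theorem stdPart_mulVec (A : Matrix (Fin n) (Fin n) DQuat) (v : Fin n → DQuat) :
    stdPart (A.mulVec v) = quatOp (A.map TrivSqZeroExt.fst) (stdPart v) := by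
  ext1 i
  exact fst_dotProduct _ _

theorem dualPart_mulVec (A : Matrix (Fin n) (Fin n) DQuat) (v : Fin n → DQuat) :
    dualPart (A.mulVec v) = quatOp (A.map TrivSqZeroExt.fst) (dualPart v) +
      quatOp (A.map TrivSqZeroExt.snd) (stdPart v) := by
  ext1 i
  exact snd_dotProduct _ _

theorem re_fst_star_dotProduct (v w : Fin n → DQuat) :
    (dotProduct (star v) w).fst.re = inner ℝ (stdPart w) (stdPart v) := by
  rw [fst_dotProduct]
  simp only [Pi.star_apply, fst_star]
  exact re_star_dotProduct (fun i => (v i).fst) _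

theorem re_snd_star_dotProduct (v w : Fin n → DQuat) :
    (dotProduct (star v) w).snd.re =
      inner ℝ (dualPart w) (stdPart v) + inner ℝ (stdPart w) (dualPart v) := by
  rw [snd_dotProduct, Quaternion.re_add]
  simp only [Pi.star_apply, fst_star, snd_star]
  exact congrArg₂ (· + ·) (re_star_dotProduct (fun i => (v i).fst) _)
    (re_star_dotProduct (fun i => (v i).snd) _)

/-! ### Dual numbers as central self-conjugate elements; Rayleigh quotients. -/

theorem fst_ofDNum (t : DNum) : (ofDNum t).fst = (t.fst : ℍ[ℝ]) := by simp [ofDNum]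

theorem snd_ofDNum (t : DNum) : (ofDNum t).snd = (t.snd : ℍ[ℝ]) := by simp [ofDNum]

theorem ofDNum_neg (t : DNum) : ofDNum (-t) = -ofDNum t := by
  ext1 <;> simp [fst_ofDNum, snd_ofDNum]

theorem ofDNum_mul (s t : DNum) : ofDNum (s * t) = ofDNum s * ofDNum t := by
  ext1 <;> simp [fst_ofDNum, snd_ofDNum]

theorem ofDNum_commutes (t : DNum) (q : DQuat) : ofDNum t * q = q * ofDNum t := by
  ext1 <;> simp [fst_ofDNum, snd_ofDNum, Quaternion.coe_commutes, add_comm]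

theorem exists_eq_ofDNum_of_star_eq {q : DQuat} (hq : star q = q) : ∃ t, q = ofDNum t := by
  refine ⟨TrivSqZeroExt.inl q.fst.re + TrivSqZeroExt.inr q.snd.re, TrivSqZeroExt.ext ?_ ?_⟩
  · rw [fst_ofDNum]
    simpa using Quaternion.star_eq_self.1 ((fst_star q).symm.trans (congrArg _ hq))
  · rw [snd_ofDNum]
    simpa using Quaternion.star_eq_self.1 ((snd_star q).symm.trans (congrArg _ hq))

theorem exists_ofDNum_inv {t : DNum} (ht : t.fst ≠ 0) :
    (∃ u, (ofDNum t)⁻¹ = ofDNum u) ∧ ofDNum t * (ofDNum t)⁻¹ = 1 := by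
  have h : (t.fst : ℍ[ℝ]) ≠ 0 := fun h => ht (Quaternion.coe_injective (by simpa using h))
  refine ⟨⟨t⁻¹, ?_⟩, ?_⟩
  · ext1 <;> simp [fst_ofDNum, snd_ofDNum]
  · ext1
    · simp [fst_ofDNum, h]
    · simp only [TrivSqZeroExt.snd_mul, TrivSqZeroExt.fst_inv, TrivSqZeroExt.snd_inv, fst_ofDNum,
        snd_ofDNum, smul_eq_mul, MulOpposite.smul_eq_mul_unop, MulOpposite.unop_op,
        TrivSqZeroExt.snd_one]
      rw [mul_neg, ← mul_assoc, mul_inv_cancel_left₀ h, neg_add_cancel]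

theorem star_dotProduct_comm {R : Type*} [Ring R] [StarRing R] (v w : Fin n → R) :
    star (dotProduct (star v) w) = dotProduct (star w) v := by
  simp [dotProduct, star_sum]

theorem exists_norm_sq {v : Fin n → DQuat} (hv : Appreciable v) :
    ∃ s : DNum, dotProduct (star v) v = ofDNum s ∧ s.fst ≠ 0 := by
  obtain ⟨s, hs⟩ := exists_eq_ofDNum_of_star_eq (star_dotProduct_comm v v)
  refine ⟨s, hs, fun h => appreciable_iff.1 hv ?_⟩
  have h1 := re_fst_star_dotProduct v v
  rw [hs, fst_ofDNum, Quaternion.re_coe, h] at h1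
  exact inner_self_eq_zero.1 h1.symm

theorem exists_rayleigh_eq {A : Matrix (Fin n) (Fin n) DQuat} (hA : A.IsHermitian)
    {v : Fin n → DQuat} (hv : Appreciable v) :
    ∃ t, rayleigh A v = ofDNum t := by
  obtain ⟨s, hs, hs0⟩ := exists_norm_sq hv
  obtain ⟨r, hr⟩ := exists_eq_ofDNum_of_star_eq (q := dotProduct (star v) (A.mulVec v))
    (by rw [star_dotProduct_comm, ← star_dotProduct_mulVec hA])
  obtain ⟨u, hu⟩ := (exists_ofDNum_inv hs0).1
  exact ⟨r * u, by rw [rayleigh, hs, hr, hu, ofDNum_mul]⟩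

theorem rayleigh_mul_norm_sq (A : Matrix (Fin n) (Fin n) DQuat) {v : Fin n → DQuat}
    (hv : Appreciable v) :
    dotProduct (star v) (A.mulVec v) = rayleigh A v * dotProduct (star v) v := by
  obtain ⟨s, hs, hs0⟩ := exists_norm_sq hv
  rw [rayleigh, mul_assoc, hs, ← ofDNum_commutes, (exists_ofDNum_inv hs0).2, mul_one]

/-- Centrality of `v* v` lets it cancel past `μ`. For Hermitian `A` this also forces every right
eigenvalue to be a dual number. -/
theorem IsRightEigenvector.rayleigh_eq {A : Matrix (Fin n) (Fin n) DQuat} {μ : DQuat}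
    {v : Fin n → DQuat} (h : IsRightEigenvector A μ v) : rayleigh A v = μ := by
  obtain ⟨s, hs, hs0⟩ := exists_norm_sq h.1
  have hμ : dotProduct (star v) (fun i => v i * μ) = dotProduct (star v) v * μ := by
    simp only [dotProduct, Finset.sum_mul, mul_assoc]
  rw [rayleigh, h.2, hμ, hs, ofDNum_commutes, mul_assoc, (exists_ofDNum_inv hs0).2, mul_one]

theorem eigenvalues_subset_rayleighValues (A : Matrix (Fin n) (Fin n) DQuat) :
    eigenvalues A ⊆ rayleighValues A := fun _ ⟨v, hv⟩ => ⟨v, hv.1, hv.rayleigh_eq⟩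

/-! ### Extremal eigenvalues bound the Rayleigh quotient. -/

theorem exists_eigenvalue_le_rayleighValues (hn : 0 < n)
    {A : Matrix (Fin n) (Fin n) DQuat} (hA : A.IsHermitian) :
    ∃ m ∈ eigenvalues A, ∀ t ∈ rayleighValues A, m ≤ t := by
  have : Nonempty (Fin n) := ⟨⟨0, hn⟩⟩
  have hP := quatOp_isSymmetric (M := A.map TrivSqZeroExt.fst) <| by
    ext1 i j
    exact (fst_star (A j i)).symm.trans (congrArg TrivSqZeroExt.fst (hA.apply i j))
  have hQ := quatOp_isSymmetric (M := A.map TrivSqZeroExt.snd) <| by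
    ext1 i j
    exact (snd_star (A j i)).symm.trans (congrArg TrivSqZeroExt.snd (hA.apply i j))
  obtain ⟨a, b, x, y, hx, hPx, hQx, hmin, hmin'⟩ := hP.exists_min_perturbed_eigenvector hQ
  refine ⟨TrivSqZeroExt.inl a + TrivSqZeroExt.inr b, ?_, ?_⟩
  · set v : Fin n → DQuat := fun i => TrivSqZeroExt.inl (x i) + TrivSqZeroExt.inr (y i) with hv
    have hvx : stdPart v = x := by ext1 i; simp [stdPart, hv]
    have hvy : dualPart v = y := by ext1 i; simp [dualPart, hv]
    refine ⟨v, appreciable_iff.2 (hvx ▸ hx), ?_⟩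
    have h1 := stdPart_mulVec A v
    have h2 := dualPart_mulVec A v
    rw [hvx, hPx] at h1
    rw [hvx, hvy, add_comm, hQx] at h2
    ext1 i
    apply TrivSqZeroExt.ext
    · refine (congrArg (fun z : QuatSpace n => z i) h1).trans ?_
      simp [fst_ofDNum, hv, Quaternion.mul_coe_eq_smul]
    · refine (congrArg (fun z : QuatSpace n => z i) h2).trans ?_
      simp [fst_ofDNum, snd_ofDNum, hv, Quaternion.mul_coe_eq_smul, add_comm]
  · rintro t ⟨v, hv, ht⟩
    have h := rayleigh_mul_norm_sq A hv
    rw [ht] at h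
    have hpos : 0 < ‖stdPart v‖ ^ 2 := by have := appreciable_iff.1 hv; positivity
    have h1 := congrArg (fun q : DQuat => q.fst.re) h
    have h2 := congrArg (fun q : DQuat => q.snd.re) h
    simp only [TrivSqZeroExt.fst_mul, TrivSqZeroExt.snd_mul, fst_ofDNum, snd_ofDNum, smul_eq_mul,
      MulOpposite.smul_eq_mul_unop, MulOpposite.unop_op, Quaternion.re_add,
      Quaternion.coe_mul_eq_smul, Quaternion.re_smul, re_fst_star_dotProduct,
      re_snd_star_dotProduct, stdPart_mulVec, dualPart_mulVec, real_inner_self_eq_norm_sq] at h1 h2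
    have ha : a ≤ t.fst := le_of_mul_le_mul_right (h1 ▸ hmin (stdPart v)) hpos
    rw [dnum_le_iff]
    simp only [TrivSqZeroExt.fst_add, TrivSqZeroExt.fst_inl, TrivSqZeroExt.fst_inr, add_zero,
      TrivSqZeroExt.snd_add, TrivSqZeroExt.snd_inl, TrivSqZeroExt.snd_inr, zero_add]
    refine ha.lt_or_eq.imp id fun hat => ⟨hat, ?_⟩
    obtain ⟨hPv, hQv⟩ := hmin' (stdPart v) (by rw [h1, hat])
    -- At a tie `P` acts on `stdPart v` as `a`, so the terms in `dualPart v` agree on both sides and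
    -- cancel.
    rw [inner_add_left, hP, hPv, real_inner_smul_left, real_inner_smul_right, ← hat] at h2
    refine le_of_mul_le_mul_right ?_ hpos
    linarith

theorem rayleigh_neg (A : Matrix (Fin n) (Fin n) DQuat) (v : Fin n → DQuat) :
    rayleigh (-A) v = -rayleigh A v := by
  rw [rayleigh, rayleigh, Matrix.neg_mulVec, dotProduct_neg, neg_mul]

theorem exists_eigenvalue_ge_rayleighValues (hn : 0 < n)
    {A : Matrix (Fin n) (Fin n) DQuat} (hA : A.IsHermitian) :
    ∃ M ∈ eigenvalues A, ∀ t ∈ rayleighValues A, t ≤ M := by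
  obtain ⟨m, ⟨v, hv, hm⟩, hle⟩ := exists_eigenvalue_le_rayleighValues hn hA.neg
  refine ⟨-m, ⟨v, hv, ?_⟩, ?_⟩
  · rw [← neg_neg (A.mulVec v), ← Matrix.neg_mulVec, hm]
    ext1 i
    rw [Pi.neg_apply, ofDNum_neg, mul_neg]
  · rintro t ⟨w, hw, ht⟩
    have h := hle (-t) ⟨w, hw, by rw [rayleigh_neg, ht, ofDNum_neg]⟩
    rw [dnum_le_iff, TrivSqZeroExt.fst_neg, TrivSqZeroExt.snd_neg] at h ⊢
    rcases h with h | ⟨h, h'⟩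
    · exact Or.inl (by linarith)
    · exact Or.inr ⟨by linarith, by linarith⟩

end DualQuat

theorem mainTheorem7 (n : ℕ) (hn : 0 < n)
    (A : Matrix (Fin n) (Fin n) DualQuat.DQuat) (hA : A.IsHermitian) :
    -- bounds, for every increasing list of the eigenvalues
    (∀ lam : Fin n → DualQuat.DNum, Monotone lam → Set.range lam = DualQuat.eigenvalues A →
      ∀ v : Fin n → DualQuat.DQuat, DualQuat.Appreciable v →
        ∃ t : DualQuat.DNum, DualQuat.rayleigh A v = DualQuat.ofDNum t ∧
          lam ⟨0, hn⟩ ≤ t ∧ t ≤ lam ⟨n - 1, Nat.sub_lt hn Nat.one_pos⟩) ∧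
    -- all right eigenvalues are dual numbers
    (∀ μ : DualQuat.DQuat, DualQuat.IsRightEigenvalue A μ →
      ∃ t : DualQuat.DNum, μ = DualQuat.ofDNum t) ∧
    -- the smallest one is the minimum of the Rayleigh quotient, attained at its eigenvectors
    (∃ m : DualQuat.DNum, IsLeast (DualQuat.eigenvalues A) m ∧
      IsLeast (DualQuat.rayleighValues A) m ∧
      ∀ v : Fin n → DualQuat.DQuat, DualQuat.IsRightEigenvector A (DualQuat.ofDNum m) v →
        DualQuat.rayleigh A v = DualQuat.ofDNum m) ∧
    -- the largest one is the maximum of the Rayleigh quotient, attained at its eigenvectors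
    (∃ M : DualQuat.DNum, IsGreatest (DualQuat.eigenvalues A) M ∧
      IsGreatest (DualQuat.rayleighValues A) M ∧
      ∀ v : Fin n → DualQuat.DQuat, DualQuat.IsRightEigenvector A (DualQuat.ofDNum M) v →
        DualQuat.rayleigh A v = DualQuat.ofDNum M) := by
  obtain ⟨m, hm, hmle⟩ := DualQuat.exists_eigenvalue_le_rayleighValues hn hA
  obtain ⟨M, hM, hMge⟩ := DualQuat.exists_eigenvalue_ge_rayleighValues hn hA
  have hsub := DualQuat.eigenvalues_subset_rayleighValues A
  refine ⟨fun lam hmono hrange v hv => ?_, ?_, ?_, ?_⟩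
  · obtain ⟨t, ht⟩ := DualQuat.exists_rayleigh_eq hA hv
    -- Multiplicities are irrelevant: both extremal eigenvalues occur in the list, and monotonicity
    -- compares them with its end entries.
    obtain ⟨i, rfl⟩ := hrange.symm.subset hm
    obtain ⟨j, rfl⟩ := hrange.symm.subset hM
    exact ⟨t, ht, (hmono (Fin.mk_le_of_le_val (Nat.zero_le _))).trans (hmle t ⟨v, hv, ht⟩),
      (hMge t ⟨v, hv, ht⟩).trans (hmono (Fin.le_def.2 (Nat.le_sub_one_of_lt j.isLt)))⟩
  · rintro μ ⟨v, hv⟩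
    obtain ⟨t, ht⟩ := DualQuat.exists_rayleigh_eq hA hv.1
    exact ⟨t, hv.rayleigh_eq.symm.trans ht⟩
  · exact ⟨m, ⟨hm, fun t ht => hmle t (hsub ht)⟩, ⟨hsub hm, hmle⟩, fun v hv => hv.rayleigh_eq⟩
  · exact ⟨M, ⟨hM, fun t ht => hMge t (hsub ht)⟩, ⟨hsub hM, hMge⟩, fun v hv => hv.rayleigh_eq⟩
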